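/- Let $\mathcal X\subseteq\mathbb R^d$, $\mathcal Y=\{0,1\}^k$, and let $\Delta$ be a real-valued metric on $\mathcal Y$ with $\Delta(\mathbf y,\mathbf y')\ge 1$ whenever $\mathbf y\ne\mathbf y'$. Let $\mathcal S_\theta,\mathcal S_\kappa$ be parameter spaces, and let $\mu_\theta:\mathcal X\times\mathcal Y\to\mathbb R^m$ and $\sigma^2_\theta:\mathcal X\times\mathcal Y\to\mathbb R^m$ ($\theta\in\mathcal S_\theta$), and $\mu_\kappa:\mathbb R^m\to\mathbb R^m$ and $\sigma^2_\kappa:\mathbb R^m\to[0,\infty)^m$ ($\kappa\in\mathcal S_\kappa$) be encoder functions, with $\mu_\kappa,\sigma_\kappa^2$ measurable. For $\nu>2$ put $$q(\hat{\mathbf z}\mid\mathbf x,\hat{\mathbf y})=\mathrm{Student}\bigl(\mu_\theta(\mathbf x,\hat{\mathbf y}),\mathrm{diag}(\sigma^2_\theta(\mathbf x,\hat{\mathbf y})),\nu\bigr),\qquad q(\mathbf z\mid\hat{\mathbf z})=\mathrm{Normal}\bigl(\mu_\kappa(\hat{\mathbf z}),\mathrm{diag}(\sigma^2_\kappa(\hat{\mathbf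 z}))\bigr),$$ and $q(\mathbf z\mid\mathbf x,\hat{\mathbf y})=\int q(\mathbf z\mid\hat{\mathbf z})\,q(\hat{\mathbf z}\mid\mathbf x,\hat{\mathbf y})\,d\hat{\mathbf z}$. Here $\mathrm{Student}(\mu,\Sigma,\nu)$ is the $m$-dimensional Student distribution with location $\mu$, scale matrix $\Sigma$ and $\nu$ degrees of freedom. Suppose that there are constants $M,L,\lambda>0$ such that for all $\theta\in\mathcal S_\theta$, $\mathbf x\in\mathcal X$ and $\mathbf y,\mathbf y'\in\mathcal Y$: 1. if $\mathbf y\neq\mathbf y'$, then $\max_{j}\ \sigma^2_\theta(\mathbf x,\mathbf y)_j/\sigma^2_\theta(\mathbf x,\mathbf y')_j\le M\,\Delta(\mathbf y,\mathbf y')$; 2. $\|\mu_\theta(\mathbf x,\mathbf y)-\mu_\theta(\mathbf x,\mathbf y')\|_2\le L\,\Delta(\mathbf y,\mathbf y')$; 3. $\sigma^2_\theta(\mathbf x,\mathbf y)_j\ge\lambda$ for all $j$. Let $\Psi$ be the digamma function, $\alpha=\sqrt{\nu\lambda}/L$ and $$C_1=\frac{\nu+m}{2}\left\{\frac{M\sqrt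 m\,\alpha}{2(\nu-2)}-\Psi\left(\frac{\nu+m}{2}\right)+\Psi\left(\frac\nu2\right)\right\},\qquad C_2=\frac{mM}{2e}+\frac{(\nu+m)\sqrt m}{2\alpha}.$$ Then for all $\theta\in\mathcal S_\theta$, $\kappa\in\mathcal S_\kappa$, $\mathbf x\in\mathcal X$ and all $\mathbf y_0\neq\mathbf y_1$ in $\mathcal Y$, $$D_{KL}\bigl[q(\mathbf z\mid\mathbf x,\hat{\mathbf y}=\mathbf y_1)\,\big\|\,q(\mathbf z\mid\mathbf x,\hat{\mathbf y}=\mathbf y_0)\bigr]\le C_1+C_2\,\Delta(\mathbf y_0,\mathbf y_1).$$ The same bound holds for $D_{KL}\bigl[q(\hat{\mathbf z}\mid\mathbf x,\hat{\mathbf y}=\mathbf y_1)\,\big\|\,q(\hat{\mathbf z}\mid\mathbf x,\hat{\mathbf y}=\mathbf y_0)\bigr]$. It also holds for the laws of $\mathbf z$ obtained when $q(\mathbf z\mid\hat{\mathbf z})$ is replaced by $\eta\,\mathrm{Normal}(\mu_\theta(\mathbf x,\mathbf y),\mathrm{diag}(\sigma^2_\theta(\mathbf x,\mathbf y)))+(1-\eta)\,q(\mathbf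 z\mid\hat{\mathbf z})$ with the same $\eta\in[0,1]$ and $\mathbf y\in\mathcal Y$ in both arguments. -/

import Mathlib

open MeasureTheory ProbabilityTheory InformationTheory

/-- Binary label vectors of length `k`. -/
abbrev LabelSpace (k : ℕ) : Type := Fin k → Fin 2

/-- A real-valued metric on the binary label vectors that takes values at least `1` on pairs of
different labels (as the Hamming distance does). -/
structure IsLabelMetric {k : ℕ} (Δ : LabelSpace k → LabelSpace k → ℝ) : Prop where
  self_eq_zero : ∀ y, Δ y y = 0
  symm : ∀ y y', Δ y y' = Δ y' y
  triangle : ∀ y y' y'', Δ y y'' ≤ Δ y y' + Δ y' y''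
  one_le : ∀ y y', y ≠ y' → 1 ≤ Δ y y'

/-- The digamma function `Ψ = Γ' / Γ` at a real argument. -/
noncomputable def realDigamma (t : ℝ) : ℝ := (Complex.digamma (t : ℂ)).re

/-- The density of the multivariate Student distribution with location `μ`, scale matrix `S`
and `ν` degrees of freedom, with respect to Lebesgue measure on `ℝᵐ`. -/
noncomputable def studentPDFReal {m : ℕ} (μ : EuclideanSpace ℝ (Fin m))
    (S : Matrix (Fin m) (Fin m) ℝ) (ν : ℝ) (z : EuclideanSpace ℝ (Fin m)) : ℝ :=
  Real.Gamma ((ν + m) / 2) /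
      (Real.Gamma (ν / 2) * (ν * Real.pi) ^ ((m : ℝ) / 2) * Real.sqrt S.det) *
    (1 + (1 / ν) * ((z - μ).ofLp ⬝ᵥ S⁻¹.mulVec (z - μ).ofLp)) ^ (-((ν + m) / 2))

/-- The multivariate Student distribution `Student(μ, S, ν)` on `ℝᵐ`. -/
noncomputable def multivariateStudent {m : ℕ} (μ : EuclideanSpace ℝ (Fin m))
    (S : Matrix (Fin m) (Fin m) ℝ) (ν : ℝ) : Measure (EuclideanSpace ℝ (Fin m)) :=
  volume.withDensity fun z => ENNReal.ofReal (studentPDFReal μ S ν z)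

/-- The normal distribution with mean `μ` and covariance matrix `diag(v)`. -/
noncomputable def diagGaussian {m : ℕ} (μ : EuclideanSpace ℝ (Fin m)) (v : Fin m → ℝ) :
    Measure (EuclideanSpace ℝ (Fin m)) :=
  multivariateGaussian μ (Matrix.diagonal v)

/-- The proposal `q(ẑ ∣ x, ŷ)` of the shifted latent variable, given the encoder outputs
`μ = μ_θ(x, ŷ)` and `v = σ²_θ(x, ŷ)`. -/
noncomputable def shiftedLatentLaw {m : ℕ} (ν : ℝ) (μ : EuclideanSpace ℝ (Fin m))
    (v : Fin m → ℝ) : Measure (EuclideanSpace ℝ (Fin m)) :=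
  multivariateStudent μ (Matrix.diagonal v) ν

/-- The marginal proposal `q(z ∣ x, ŷ) = ∫ q(z ∣ ẑ) q(ẑ ∣ x, ŷ) dẑ` with
`q(z ∣ ẑ) = Normal(μ_κ(ẑ), diag(σ²_κ(ẑ)))`. Here `Q` is the law `q(ẑ ∣ x, ŷ)`. -/
noncomputable def latentLaw {m : ℕ}
    (μκ : EuclideanSpace ℝ (Fin m) → EuclideanSpace ℝ (Fin m))
    (vκ : EuclideanSpace ℝ (Fin m) → Fin m → ℝ)
    (Q : Measure (EuclideanSpace ℝ (Fin m))) : Measure (EuclideanSpace ℝ (Fin m)) :=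
  Q.bind fun zhat => diagGaussian (μκ zhat) (vκ zhat)

/-- The marginal proposal in the supervised setting, where the transition is the mixture
`q(z ∣ x, y, ẑ) = η Normal(μ, diag(v)) + (1 - η) q(z ∣ ẑ)` with `μ = μ_θ(x, y)` and
`v = σ²_θ(x, y)`. Here `Q` is the law `q(ẑ ∣ x, ŷ)`. -/
noncomputable def supervisedLatentLaw {m : ℕ} (η : ℝ)
    (μ : EuclideanSpace ℝ (Fin m)) (v : Fin m → ℝ)
    (μκ : EuclideanSpace ℝ (Fin m) → EuclideanSpace ℝ (Fin m))
    (vκ : EuclideanSpace ℝ (Fin m) → Fin m → ℝ)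
    (Q : Measure (EuclideanSpace ℝ (Fin m))) : Measure (EuclideanSpace ℝ (Fin m)) :=
  Q.bind fun zhat =>
    ENNReal.ofReal η • diagGaussian μ v +
      ENNReal.ofReal (1 - η) • diagGaussian (μκ zhat) (vκ zhat)

/-- `D_KL[P ‖ Q] ≤ B` for a real number `B`; in particular the divergence is finite. -/
def KLBoundedBy {E : Type*} [MeasurableSpace E] (P Q : Measure E) (B : ℝ) : Prop :=
  klDiv P Q ≠ ⊤ ∧ (klDiv P Q).toReal ≤ B

/-- `α = √(ν λ) / L`. -/
noncomputable def alphaConst (ν lam L : ℝ) : ℝ := Real.sqrt (ν * lam) / L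

/-- The constant term `C₁` of the bound. -/
noncomputable def boundC₁ (m : ℕ) (ν lam L M : ℝ) : ℝ :=
  (ν + m) / 2 *
    (M * Real.sqrt m * alphaConst ν lam L / (2 * (ν - 2))
      - realDigamma ((ν + m) / 2) + realDigamma (ν / 2))

/-- The coefficient `C₂` of the label distance in the bound. -/
noncomputable def boundC₂ (m : ℕ) (ν lam L M : ℝ) : ℝ :=
  m * M / (2 * Real.exp 1) + (ν + m) * Real.sqrt m / (2 * alphaConst ν lam L)

/-! ### Gamma and Gaussian integrals -/

section GammaIntegrals

/-! Both laws of `z` arise from the two Student laws through one and the same Markov kernel, and the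
supervised mixture is again such a kernel. By data processing (`KLBoundedBy.bind`) everything
reduces to the divergence between two Student laws with diagonal scale.

Put `s = (ν + m) / 2`. An affine change of variables turns the first law into the one with density
proportional to `(1 + ‖w‖²)⁻ˢ`. The log-likelihood ratio becomes a constant, minus `s log (1 +
‖w‖²)`, plus `s log X(w)`, where `X ≥ 1` is bounded by a quadratic `Y`. The constant is at most `m R
/ (2e)` since `log x ≤ x / e`. The mean of the first logarithm is `Ψ(s) - Ψ(ν / 2)`
(`integral_log_stdStudent`). For the second, Jensen gives at most `log E[Y]`: the linear part of `Y`
averages to zero by symmetry and `E‖w‖² = m / (ν - 2)`, which is where `ν > 2` enters. This is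
`klBoundedBy_multivariateStudent_diagonal`.

With `R = M Δ` and `D = L Δ`, what remains is to bound the logarithm of a quadratic in `Δ` by an
affine function, which follows from `1 + t² ≤ exp t` (`student_bound_le`). -/

lemma lintegral_rpow_mul_exp_neg_mul_Ioi {a r : ℝ} (ha : 0 < a) (hr : 0 < r) :
    ∫⁻ t in Set.Ioi (0 : ℝ), ENNReal.ofReal (t ^ (a - 1) * Real.exp (-(r * t)))
      = ENNReal.ofReal ((1 / r) ^ a * Real.Gamma a) := by
  have h := Real.integral_rpow_mul_exp_neg_mul_Ioi ha hr
  have hpos : 0 < (1 / r) ^ a * Real.Gamma a :=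
    mul_pos (Real.rpow_pos_of_pos (by positivity) _) (Real.Gamma_pos_of_pos ha)
  rw [← h, ofReal_integral_eq_lintegral_ofReal]
  -- Integrability comes for free: the Bochner integral of a nonintegrable function is zero, but its
  -- known value is positive.
  · by_contra hne
    rw [integral_undef hne] at h
    exact hpos.ne h
  · filter_upwards [ae_restrict_mem measurableSet_Ioi] with t ht
    exact mul_nonneg (Real.rpow_nonneg (le_of_lt ht) _) (Real.exp_nonneg _)

variable {V : Type*} [NormedAddCommGroup V] [InnerProductSpace ℝ V] [FiniteDimensional ℝ V]
  [MeasurableSpace V] [BorelSpace V]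

lemma lintegral_exp_neg_mul_sq_norm {b : ℝ} (hb : 0 < b) :
    ∫⁻ v : V, ENNReal.ofReal (Real.exp (-b * ‖v‖ ^ 2))
      = ENNReal.ofReal ((Real.pi / b) ^ (Module.finrank ℝ V / 2 : ℝ)) := by
  have h := GaussianFourier.integral_rexp_neg_mul_sq_norm (V := V) hb
  have hpos : 0 < (Real.pi / b) ^ (Module.finrank ℝ V / 2 : ℝ) :=
    Real.rpow_pos_of_pos (div_pos Real.pi_pos hb) _
  rw [← h, ofReal_integral_eq_lintegral_ofReal]
  · by_contra hne
    rw [integral_undef hne] at h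
    exact hpos.ne h
  · exact .of_forall fun _ => Real.exp_nonneg _

/-- The total mass of `(1 + ‖w‖²)⁻ˢ` on a Euclidean space. -/
noncomputable def studentMass (n : ℕ) (s : ℝ) : ℝ :=
  Real.pi ^ (n / 2 : ℝ) * Real.Gamma (s - n / 2) / Real.Gamma s

lemma studentMass_pos {n : ℕ} {s : ℝ} (hs : (n : ℝ) / 2 < s) : 0 < studentMass n s := by
  have h0 : (0 : ℝ) ≤ n / 2 := by positivity
  exact div_pos (mul_pos (Real.rpow_pos_of_pos Real.pi_pos _)
    (Real.Gamma_pos_of_pos (by linarith))) (Real.Gamma_pos_of_pos (by linarith))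

/-- The Student density is a Gamma mixture of Gaussians: `Γ(s) (1 + ‖w‖²)⁻ˢ` is the integral of `t ^
(s - 1) exp (-(1 + ‖w‖²) t)` over `t > 0`. Tonelli then leaves a Gaussian integral in `w` and a
Gamma integral in `t`. -/
lemma lintegral_one_add_norm_sq_rpow_neg {s : ℝ} (hs : (Module.finrank ℝ V : ℝ) / 2 < s) :
    ∫⁻ w : V, ENNReal.ofReal ((1 + ‖w‖ ^ 2) ^ (-s))
      = ENNReal.ofReal (studentMass (Module.finrank ℝ V) s) := by
  set n := Module.finrank ℝ V with hn
  have h0 : (0 : ℝ) ≤ n / 2 := by positivity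
  have hs0 : 0 < s := by linarith
  have hΓ := Real.Gamma_pos_of_pos hs0
  have hleft (w : V) : ENNReal.ofReal (Real.Gamma s) * ENNReal.ofReal ((1 + ‖w‖ ^ 2) ^ (-s))
      = ∫⁻ t in Set.Ioi (0 : ℝ),
        ENNReal.ofReal (t ^ (s - 1) * Real.exp (-((1 + ‖w‖ ^ 2) * t))) := by
    have hw : 0 < 1 + ‖w‖ ^ 2 := by positivity
    rw [lintegral_rpow_mul_exp_neg_mul_Ioi hs0 hw, ← ENNReal.ofReal_mul hΓ.le, mul_comm,
      one_div, Real.inv_rpow hw.le, Real.rpow_neg hw.le]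
  have hright (t : ℝ) (ht : t ∈ Set.Ioi (0 : ℝ)) :
      ∫⁻ w : V, ENNReal.ofReal (t ^ (s - 1) * Real.exp (-((1 + ‖w‖ ^ 2) * t)))
        = ENNReal.ofReal (Real.pi ^ (n / 2 : ℝ)) *
          ENNReal.ofReal (t ^ (s - n / 2 - 1) * Real.exp (-(1 * t))) := by
    have ht : 0 < t := ht
    have hc : 0 ≤ t ^ (s - 1) * Real.exp (-t) := by positivity
    calc ∫⁻ w : V, ENNReal.ofReal (t ^ (s - 1) * Real.exp (-((1 + ‖w‖ ^ 2) * t)))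
        = ∫⁻ w : V, ENNReal.ofReal (t ^ (s - 1) * Real.exp (-t)) *
            ENNReal.ofReal (Real.exp (-t * ‖w‖ ^ 2)) := by
          congr 1 with w
          rw [← ENNReal.ofReal_mul hc, mul_assoc, ← Real.exp_add]
          ring_nf
      _ = _ := by
          rw [lintegral_const_mul _ (by fun_prop), lintegral_exp_neg_mul_sq_norm ht,
            ← ENNReal.ofReal_mul hc, ← ENNReal.ofReal_mul (by positivity),
            Real.div_rpow Real.pi_pos.le ht.le, one_mul,
            show s - n / 2 - 1 = (s - 1) - n / 2 by ring, Real.rpow_sub ht (s - 1), ← hn]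
          congr 1
          ring
  have key : ENNReal.ofReal (Real.Gamma s) * ∫⁻ w : V, ENNReal.ofReal ((1 + ‖w‖ ^ 2) ^ (-s))
      = ENNReal.ofReal (Real.pi ^ (n / 2 : ℝ) * Real.Gamma (s - n / 2)) := by
    rw [← lintegral_const_mul _ (by fun_prop)]
    simp_rw [hleft]
    rw [lintegral_lintegral_swap (by fun_prop), setLIntegral_congr_fun measurableSet_Ioi hright,
      lintegral_const_mul _ (by fun_prop),
      lintegral_rpow_mul_exp_neg_mul_Ioi (by linarith) one_pos,
      ← ENNReal.ofReal_mul (by positivity)]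
    simp
  rw [studentMass, ENNReal.ofReal_div_of_pos hΓ, ← key, mul_comm,
    ENNReal.mul_div_cancel_right (by simpa using hΓ) ENNReal.ofReal_ne_top]

lemma integrable_one_add_norm_sq_rpow_neg {s : ℝ} (hs : (Module.finrank ℝ V : ℝ) / 2 < s) :
    Integrable fun w : V => (1 + ‖w‖ ^ 2) ^ (-s) := by
  have hm : Measurable fun w : V => (1 + ‖w‖ ^ 2) ^ (-s) := by fun_prop
  refine ⟨hm.aestronglyMeasurable, ?_⟩
  rw [hasFiniteIntegral_iff_ofReal (.of_forall fun w => by positivity),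
    lintegral_one_add_norm_sq_rpow_neg hs]
  exact ENNReal.ofReal_lt_top

lemma integral_one_add_norm_sq_rpow_neg {s : ℝ} (hs : (Module.finrank ℝ V : ℝ) / 2 < s) :
    ∫ w : V, (1 + ‖w‖ ^ 2) ^ (-s) = studentMass (Module.finrank ℝ V) s := by
  rw [integral_eq_lintegral_of_nonneg_ae (.of_forall fun w => by positivity)
    (integrable_one_add_norm_sq_rpow_neg hs).1, lintegral_one_add_norm_sq_rpow_neg hs,
    ENNReal.toReal_ofReal (studentMass_pos hs).le]

lemma studentMass_sub_one {n : ℕ} {s : ℝ} (hs : (n : ℝ) / 2 + 1 < s) :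
    studentMass n (s - 1) = (s - 1) / (s - 1 - n / 2) * studentMass n s := by
  have h0 : (0 : ℝ) ≤ n / 2 := by positivity
  have h1 : 0 < s - 1 := by linarith
  have h2 : 0 < s - 1 - n / 2 := by linarith
  have e1 : Real.Gamma s = (s - 1) * Real.Gamma (s - 1) := by
    rw [← Real.Gamma_add_one h1.ne']; ring_nf
  have e2 : Real.Gamma (s - n / 2) = (s - 1 - n / 2) * Real.Gamma (s - 1 - n / 2) := by
    rw [← Real.Gamma_add_one h2.ne']; ring_nf
  have h3 := Real.Gamma_pos_of_pos h1
  have h4 := Real.Gamma_pos_of_pos h2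
  rw [studentMass, studentMass, e1, e2]
  generalize s - 1 - (n : ℝ) / 2 = r at *
  field_simp

end GammaIntegrals

/-! ### The digamma function as a logarithmic derivative -/

section Digamma

lemma hasDerivAt_log_Gamma {t : ℝ} (ht : 0 < t) :
    HasDerivAt (fun u => Real.log (Real.Gamma u)) (realDigamma t) t := by
  have hne : ∀ k : ℕ, (t : ℂ) ≠ -k := by
    intro k hk
    have : t = -k := by exact_mod_cast hk
    have hk0 : (0 : ℝ) ≤ k := k.cast_nonneg
    linarith
  have hC := (Complex.differentiableAt_Gamma (t : ℂ) hne).hasDerivAt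
  have hR : HasDerivAt Real.Gamma (deriv Complex.Gamma t).re t := hC.real_of_complex
  have hpos := Real.Gamma_pos_of_pos ht
  convert hR.log hpos.ne' using 1
  rw [realDigamma, Complex.digamma_def, logDeriv_apply, Complex.Gamma_ofReal,
    Complex.div_ofReal_re]

lemma hasDerivAt_studentMass {n : ℕ} {s : ℝ} (hs : (n : ℝ) / 2 < s) :
    HasDerivAt (studentMass n)
      (studentMass n s * (realDigamma (s - n / 2) - realDigamma s)) s := by
  have h0 : (0 : ℝ) ≤ n / 2 := by positivity
  have h1 := hasDerivAt_log_Gamma (t := s) (by linarith)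
  have h2 := (hasDerivAt_log_Gamma (t := s - n / 2) (by linarith)).comp_sub_const s (n / 2 : ℝ)
  have h3 := ((h2.sub h1).exp).const_mul (Real.pi ^ (n / 2 : ℝ))
  have key : ∀ u : ℝ, (n : ℝ) / 2 < u → Real.pi ^ (n / 2 : ℝ) *
      Real.exp (Real.log (Real.Gamma (u - n / 2)) - Real.log (Real.Gamma u))
        = studentMass n u := by
    intro u hu
    rw [Real.exp_sub, Real.exp_log (Real.Gamma_pos_of_pos (by linarith)),
      Real.exp_log (Real.Gamma_pos_of_pos (by linarith)), studentMass, mul_div_assoc]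
  refine (h3.congr_of_eventuallyEq ?_).congr_deriv ?_
  · filter_upwards [lt_mem_nhds hs] with u hu
    exact (key u hu).symm
  · rw [← key s hs]
    simp only [Pi.sub_apply]
    ring

end Digamma

lemma rpow_neg_div_mul_rpow_sub {r : ℝ} (hr : 0 < r) (c s u : ℝ) :
    r ^ (-s) / c * r ^ (s - u) = r ^ (-u) / c := by
  rw [div_mul_eq_mul_div, ← Real.rpow_add hr]
  ring_nf

/-! ### Moments and mean logarithm of the standard Student law -/

section StandardStudent

variable {V : Type*} [NormedAddCommGroup V] [InnerProductSpace ℝ V] [FiniteDimensional ℝ V]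
  [MeasurableSpace V] [BorelSpace V]

/-- The probability measure on a Euclidean space with density proportional to
`(1 + ‖w‖²)⁻ˢ`. -/
noncomputable def stdStudent (V : Type*) [NormedAddCommGroup V] [InnerProductSpace ℝ V]
    [FiniteDimensional ℝ V] [MeasurableSpace V] [BorelSpace V] (s : ℝ) : Measure V :=
  volume.withDensity fun w =>
    ENNReal.ofReal ((1 + ‖w‖ ^ 2) ^ (-s) / studentMass (Module.finrank ℝ V) s)

variable {s : ℝ}

lemma isProbabilityMeasure_stdStudent (hs : (Module.finrank ℝ V : ℝ) / 2 < s) :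
    IsProbabilityMeasure (stdStudent V s) := by
  have hI := studentMass_pos hs
  refine ⟨?_⟩
  rw [stdStudent, withDensity_apply _ .univ, Measure.restrict_univ]
  simp_rw [ENNReal.ofReal_div_of_pos hI, div_eq_mul_inv]
  rw [lintegral_mul_const _ (by fun_prop), lintegral_one_add_norm_sq_rpow_neg hs,
    ENNReal.mul_inv_cancel (by simpa using hI) ENNReal.ofReal_ne_top]

lemma integral_stdStudent (hs : (Module.finrank ℝ V : ℝ) / 2 < s) (f : V → ℝ) :
    ∫ w, f w ∂(stdStudent V s)
      = ∫ w, (1 + ‖w‖ ^ 2) ^ (-s) / studentMass (Module.finrank ℝ V) s * f w := by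
  have hI := studentMass_pos hs
  rw [stdStudent, integral_withDensity_eq_integral_toReal_smul (by fun_prop)
    (.of_forall fun _ => ENNReal.ofReal_lt_top)]
  congr 1 with w
  rw [ENNReal.toReal_ofReal (by positivity), smul_eq_mul]

lemma integrable_stdStudent_iff (hs : (Module.finrank ℝ V : ℝ) / 2 < s) (f : V → ℝ) :
    Integrable f (stdStudent V s) ↔
      Integrable fun w => (1 + ‖w‖ ^ 2) ^ (-s) / studentMass (Module.finrank ℝ V) s * f w := by
  have hI := studentMass_pos hs
  rw [stdStudent, integrable_withDensity_iff_integrable_smul' (by fun_prop)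
    (.of_forall fun _ => ENNReal.ofReal_lt_top)]
  refine integrable_congr (.of_forall fun w => ?_)
  simp only
  rw [ENNReal.toReal_ofReal (by positivity), smul_eq_mul]

lemma integrable_stdStudent_rpow {u : ℝ} (hs : (Module.finrank ℝ V : ℝ) / 2 < s)
    (hu : (Module.finrank ℝ V : ℝ) / 2 < u) :
    Integrable (fun w : V => (1 + ‖w‖ ^ 2) ^ (s - u)) (stdStudent V s) := by
  rw [integrable_stdStudent_iff hs]
  simp_rw [rpow_neg_div_mul_rpow_sub (show 0 < 1 + ‖_‖ ^ 2 by positivity)]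
  exact (integrable_one_add_norm_sq_rpow_neg hu).div_const _

lemma integral_stdStudent_rpow {u : ℝ} (hs : (Module.finrank ℝ V : ℝ) / 2 < s)
    (hu : (Module.finrank ℝ V : ℝ) / 2 < u) :
    ∫ w : V, (1 + ‖w‖ ^ 2) ^ (s - u) ∂(stdStudent V s)
      = studentMass (Module.finrank ℝ V) u / studentMass (Module.finrank ℝ V) s := by
  rw [integral_stdStudent hs]
  simp_rw [rpow_neg_div_mul_rpow_sub (show 0 < 1 + ‖_‖ ^ 2 by positivity)]
  rw [integral_div, integral_one_add_norm_sq_rpow_neg hu]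

lemma integral_stdStudent_eq_zero_of_odd (hs : (Module.finrank ℝ V : ℝ) / 2 < s) {f : V → ℝ}
    (hf : ∀ w, f (-w) = -f w) : ∫ w, f w ∂(stdStudent V s) = 0 := by
  rw [integral_stdStudent hs]
  have h := integral_neg_eq_self (fun w : V =>
    (1 + ‖w‖ ^ 2) ^ (-s) / studentMass (Module.finrank ℝ V) s * f w) volume
  simp only [norm_neg, hf, mul_neg, integral_neg] at h
  linarith

/-- Multiplying the density by `1 + ‖w‖²` lowers the exponent from `s` to `s - 1`, which must still
exceed half the dimension. For `s = (ν + m) / 2` this is the condition `ν > 2`. -/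
lemma integrable_norm_sq_stdStudent (hs : (Module.finrank ℝ V : ℝ) / 2 + 1 < s) :
    Integrable (fun w : V => ‖w‖ ^ 2) (stdStudent V s) := by
  have := isProbabilityMeasure_stdStudent (V := V) (s := s) (by linarith)
  have h := (integrable_stdStudent_rpow (V := V) (s := s) (u := s - 1) (by linarith)
    (by linarith)).sub (integrable_const 1)
  refine h.congr (.of_forall fun w => ?_)
  simp

lemma integral_norm_sq_stdStudent (hs : (Module.finrank ℝ V : ℝ) / 2 + 1 < s) :
    ∫ w : V, ‖w‖ ^ 2 ∂(stdStudent V s)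
      = (Module.finrank ℝ V / 2) / (s - 1 - Module.finrank ℝ V / 2) := by
  have hs' : (Module.finrank ℝ V : ℝ) / 2 < s := by linarith
  have := isProbabilityMeasure_stdStudent hs'
  have h := integral_stdStudent_rpow (V := V) (s := s) (u := s - 1) hs' (by linarith)
  rw [studentMass_sub_one hs, mul_div_cancel_right₀ _ (studentMass_pos hs').ne'] at h
  have e : (fun w : V => (1 + ‖w‖ ^ 2) ^ (s - (s - 1))) = fun w => 1 + ‖w‖ ^ 2 := by
    ext w; simp
  rw [e, integral_add (integrable_const _) (integrable_norm_sq_stdStudent hs)] at h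
  have h2 : s - 1 - (Module.finrank ℝ V : ℝ) / 2 ≠ 0 := by linarith
  simp only [integral_const, probReal_univ, smul_eq_mul, mul_one] at h
  rw [eq_sub_of_add_eq' h, eq_div_iff h2, sub_mul, div_mul_cancel₀ _ h2]
  ring

lemma integrable_inner_stdStudent (hs : (Module.finrank ℝ V : ℝ) / 2 + 1 < s) (c : V) :
    Integrable (fun w : V => inner ℝ c w) (stdStudent V s) := by
  have := isProbabilityMeasure_stdStudent (V := V) (s := s) (by linarith)
  refine ((integrable_norm_sq_stdStudent hs).add (integrable_const (‖c‖ ^ 2))).mono'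
    (by fun_prop) (.of_forall fun w => ?_)
  have h := norm_inner_le_norm (𝕜 := ℝ) c w
  simp only [Pi.add_apply]
  nlinarith [sq_nonneg (‖c‖ - ‖w‖), sq_nonneg (‖c‖ + ‖w‖)]

lemma integral_inner_stdStudent (hs : (Module.finrank ℝ V : ℝ) / 2 < s) (c : V) :
    ∫ w : V, inner ℝ c w ∂(stdStudent V s) = 0 :=
  integral_stdStudent_eq_zero_of_odd hs fun w => by simp

lemma integrable_log_stdStudent (hs : (Module.finrank ℝ V : ℝ) / 2 + 1 < s) :
    Integrable (fun w : V => Real.log (1 + ‖w‖ ^ 2)) (stdStudent V s) := by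
  refine (integrable_norm_sq_stdStudent hs).mono'
    (Measurable.aestronglyMeasurable (by fun_prop)) (.of_forall fun w => ?_)
  rw [Real.norm_of_nonneg (Real.log_nonneg (by nlinarith [sq_nonneg ‖w‖]))]
  linarith [Real.log_le_sub_one_of_pos (show 0 < 1 + ‖w‖ ^ 2 by positivity)]

/-- The mean is minus the logarithmic derivative of `studentMass` at `s`. Differentiation under the
integral is avoided: integrating `exp t ≥ 1 + t` gives a nonnegative function of the exponent `u`
that vanishes at `u = s`, so its derivative there is zero. -/
lemma integral_log_stdStudent (hs : (Module.finrank ℝ V : ℝ) / 2 + 1 < s) :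
    ∫ w : V, Real.log (1 + ‖w‖ ^ 2) ∂(stdStudent V s)
      = realDigamma s - realDigamma (s - Module.finrank ℝ V / 2) := by
  have hs' : (Module.finrank ℝ V : ℝ) / 2 < s := by linarith
  have := isProbabilityMeasure_stdStudent hs'
  have hI := studentMass_pos hs'
  set n := Module.finrank ℝ V with hn
  set J := ∫ w : V, Real.log (1 + ‖w‖ ^ 2) ∂(stdStudent V s) with hJ
  have hmin : ∀ u, (n : ℝ) / 2 < u →
      0 ≤ studentMass n u / studentMass n s - 1 + (u - s) * J := by
    intro u hu
    have hr := integrable_stdStudent_rpow hs' hu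
    have hsub : ∫ w : V, ((1 + ‖w‖ ^ 2) ^ (s - u) - 1 + (u - s) * Real.log (1 + ‖w‖ ^ 2))
        ∂(stdStudent V s) = studentMass n u / studentMass n s - 1 + (u - s) * J := by
      have hr1 : Integrable (fun w : V => (1 + ‖w‖ ^ 2) ^ (s - u) - 1) (stdStudent V s) :=
        hr.sub (integrable_const _)
      rw [integral_add hr1 ((integrable_log_stdStudent hs).const_mul _), integral_sub hr (integrable_const _),
        integral_stdStudent_rpow hs' hu, integral_const_mul]
      simp [hJ, hn]
    rw [← hsub]
    refine integral_nonneg fun w => ?_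
    -- The tangent inequality for `exp`, at `t = (s - u) log (1 + ‖w‖²)`.
    have h1 := Real.add_one_le_exp (Real.log (1 + ‖w‖ ^ 2) * (s - u))
    rw [← Real.rpow_def_of_pos (by positivity)] at h1
    simp only [Pi.zero_apply]
    linarith
  have hloc : IsLocalMin (fun u => studentMass n u / studentMass n s - 1 + (u - s) * J) s := by
    filter_upwards [lt_mem_nhds hs'] with u hu
    have := hmin u hu
    simpa [div_self hI.ne'] using this
  have hd : HasDerivAt (fun u => studentMass n u / studentMass n s - 1 + (u - s) * J)
      ((studentMass n s * (realDigamma (s - n / 2) - realDigamma s)) / studentMass n s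
        + 1 * J) s :=
    (((hasDerivAt_studentMass hs').div_const _).sub_const 1).add
      (((hasDerivAt_id s).sub_const s).mul_const J)
  have h0 := hloc.hasDerivAt_eq_zero hd
  rw [mul_div_cancel_left₀ _ hI.ne'] at h0
  linarith

end StandardStudent

/-! ### Student laws with diagonal scale as affine images -/

section MultivariateStudent

variable {m : ℕ}

/-- The squared Mahalanobis distance of `z` from `μ` for the scale matrix `diag(v)`. -/
noncomputable def diagMahalanobisSq (μ : EuclideanSpace ℝ (Fin m)) (v : Fin m → ℝ)
    (z : EuclideanSpace ℝ (Fin m)) : ℝ :=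
  ∑ j, (z j - μ j) ^ 2 / v j

lemma diagMahalanobisSq_nonneg (μ : EuclideanSpace ℝ (Fin m)) {v : Fin m → ℝ}
    (hv : ∀ j, 0 < v j) (z : EuclideanSpace ℝ (Fin m)) : 0 ≤ diagMahalanobisSq μ v z :=
  Finset.sum_nonneg fun j _ => div_nonneg (sq_nonneg _) (hv j).le

lemma measurable_diagMahalanobisSq (μ : EuclideanSpace ℝ (Fin m)) (v : Fin m → ℝ) :
    Measurable (diagMahalanobisSq μ v) := by
  unfold diagMahalanobisSq
  fun_prop

/-- The normalizing constant of the Student density with scale matrix `diag(v)`. -/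
noncomputable def studentConst (m : ℕ) (v : Fin m → ℝ) (ν : ℝ) : ℝ :=
  Real.Gamma ((ν + m) / 2) /
    (Real.Gamma (ν / 2) * (ν * Real.pi) ^ ((m : ℝ) / 2) * Real.sqrt (∏ j, v j))

lemma studentConst_pos {v : Fin m → ℝ} (hv : ∀ j, 0 < v j) {ν : ℝ} (hν : 0 < ν) :
    0 < studentConst m v ν := by
  have h1 : 0 < Real.Gamma ((ν + m) / 2) := Real.Gamma_pos_of_pos (by positivity)
  have h2 : 0 < Real.Gamma (ν / 2) := Real.Gamma_pos_of_pos (by positivity)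
  have h3 : 0 < ∏ j, v j := Finset.prod_pos fun j _ => hv j
  unfold studentConst
  positivity

lemma studentPDFReal_diagonal (μ : EuclideanSpace ℝ (Fin m)) {v : Fin m → ℝ}
    (hv : ∀ j, 0 < v j) (ν : ℝ) (z : EuclideanSpace ℝ (Fin m)) :
    studentPDFReal μ (Matrix.diagonal v) ν z
      = studentConst m v ν * (1 + diagMahalanobisSq μ v z / ν) ^ (-((ν + m) / 2)) := by
  have hinv : (Matrix.diagonal v)⁻¹ = Matrix.diagonal fun j => (v j)⁻¹ := by
    refine Matrix.inv_eq_right_inv ?_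
    rw [Matrix.diagonal_mul_diagonal, ← Matrix.diagonal_one]
    congr 1 with j
    exact mul_inv_cancel₀ (hv j).ne'
  rw [studentPDFReal, studentConst, hinv, Matrix.det_diagonal]
  congr 3
  rw [one_div, mul_comm, div_eq_mul_inv]
  congr 1
  simp only [dotProduct, Matrix.mulVec_diagonal, diagMahalanobisSq]
  refine Finset.sum_congr rfl fun j _ => ?_
  simp only [PiLp.sub_apply]
  ring

lemma studentPDFReal_diagonal_pos (μ : EuclideanSpace ℝ (Fin m)) {v : Fin m → ℝ}
    (hv : ∀ j, 0 < v j) {ν : ℝ} (hν : 0 < ν) (z : EuclideanSpace ℝ (Fin m)) :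
    0 < studentPDFReal μ (Matrix.diagonal v) ν z := by
  have h1 := studentConst_pos hv hν
  have h2 := diagMahalanobisSq_nonneg μ hv z
  rw [studentPDFReal_diagonal μ hv]
  positivity

lemma measurable_studentPDFReal_diagonal (μ : EuclideanSpace ℝ (Fin m)) {v : Fin m → ℝ}
    (hv : ∀ j, 0 < v j) (ν : ℝ) : Measurable (studentPDFReal μ (Matrix.diagonal v) ν) := by
  have h := measurable_diagMahalanobisSq μ v
  rw [show studentPDFReal μ (Matrix.diagonal v) ν = _ from
    funext (studentPDFReal_diagonal μ hv ν)]
  fun_prop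

/-- The affine map that carries the standard Student distribution to `Student(μ, diag(v), ν)`. -/
noncomputable def studentMap (μ : EuclideanSpace ℝ (Fin m)) (v : Fin m → ℝ) (ν : ℝ)
    (w : EuclideanSpace ℝ (Fin m)) : EuclideanSpace ℝ (Fin m) :=
  μ + Matrix.toEuclideanLin (Matrix.diagonal fun j => Real.sqrt (ν * v j)) w

lemma studentMap_apply (μ : EuclideanSpace ℝ (Fin m)) (v : Fin m → ℝ) (ν : ℝ)
    (w : EuclideanSpace ℝ (Fin m)) (j : Fin m) :
    studentMap μ v ν w j = μ j + Real.sqrt (ν * v j) * w j := by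
  simp [studentMap, Matrix.toLpLin_apply, Matrix.mulVec_diagonal]

lemma measurable_studentMap (μ : EuclideanSpace ℝ (Fin m)) (v : Fin m → ℝ) (ν : ℝ) :
    Measurable (studentMap μ v ν) :=
  ((LinearMap.continuous_of_finiteDimensional _).measurable).const_add μ

lemma map_studentMap_volume (μ : EuclideanSpace ℝ (Fin m)) {v : Fin m → ℝ}
    (hv : ∀ j, 0 < v j) {ν : ℝ} (hν : 0 < ν) :
    ENNReal.ofReal (∏ j, Real.sqrt (ν * v j)) •
      (volume : Measure (EuclideanSpace ℝ (Fin m))).map (studentMap μ v ν) = volume := by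
  set T := Matrix.toEuclideanLin (Matrix.diagonal fun j => Real.sqrt (ν * v j)) with hT
  have hdet : LinearMap.det T = ∏ j, Real.sqrt (ν * v j) := by
    rw [hT, Matrix.toEuclideanLin_eq_toLin_orthonormal, LinearMap.det_toLin,
      Matrix.det_diagonal]
  have hpos : 0 < ∏ j, Real.sqrt (ν * v j) :=
    Finset.prod_pos fun j _ => Real.sqrt_pos.2 (mul_pos hν (hv j))
  have hcomp : studentMap μ v ν = (fun z => μ + z) ∘ T := rfl
  have hTm : Measurable T := (LinearMap.continuous_of_finiteDimensional T).measurable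
  rw [hcomp, ← Measure.map_map (by fun_prop) hTm,
    Measure.map_linearMap_addHaar_eq_smul_addHaar _ (by rw [hdet]; exact hpos.ne'),
    Measure.map_smul, map_add_left_eq_self, hdet, smul_smul,
    abs_of_pos (inv_pos.2 hpos), ← ENNReal.ofReal_mul hpos.le, mul_inv_cancel₀ hpos.ne',
    ENNReal.ofReal_one, one_smul]

lemma diagMahalanobisSq_studentMap_self (μ : EuclideanSpace ℝ (Fin m)) {v : Fin m → ℝ}
    (hv : ∀ j, 0 < v j) {ν : ℝ} (hν : 0 < ν) (w : EuclideanSpace ℝ (Fin m)) :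
    diagMahalanobisSq μ v (studentMap μ v ν w) / ν = ‖w‖ ^ 2 := by
  rw [EuclideanSpace.norm_sq_eq, diagMahalanobisSq, Finset.sum_div]
  refine Finset.sum_congr rfl fun j _ => ?_
  have := hv j
  rw [studentMap_apply, add_sub_cancel_left, mul_pow, Real.sq_sqrt (by positivity),
    Real.norm_eq_abs, sq_abs]
  field_simp

lemma studentConst_mul_prod {v : Fin m → ℝ} (hv : ∀ j, 0 < v j) {ν : ℝ} (hν : 0 < ν) :
    (∏ j, Real.sqrt (ν * v j)) * studentConst m v ν = (studentMass m ((ν + m) / 2))⁻¹ := by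
  have h1 : 0 < Real.Gamma ((ν + m) / 2) := Real.Gamma_pos_of_pos (by positivity)
  have h2 : 0 < Real.Gamma (ν / 2) := Real.Gamma_pos_of_pos (by positivity)
  have h3 : 0 < ∏ j, v j := Finset.prod_pos fun j _ => hv j
  have h4 : ∏ j, Real.sqrt (ν * v j) = ν ^ ((m : ℝ) / 2) * Real.sqrt (∏ j, v j) := by
    rw [← Real.sqrt_prod _ fun j _ => (mul_pos hν (hv j)).le, Finset.prod_mul_distrib,
      Finset.prod_const, Finset.card_univ, Fintype.card_fin, Real.sqrt_mul (by positivity),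
      Real.sqrt_eq_rpow, ← Real.rpow_natCast_mul hν.le]
    ring_nf
  rw [h4, studentConst, studentMass, Real.mul_rpow hν.le Real.pi_pos.le,
    show (ν + m) / 2 - (m : ℝ) / 2 = ν / 2 by ring]
  have h5 : 0 < ν ^ ((m : ℝ) / 2) := by positivity
  have h6 : 0 < Real.sqrt (∏ j, v j) := by positivity
  field_simp

lemma multivariateStudent_diagonal_eq_map (μ : EuclideanSpace ℝ (Fin m)) {v : Fin m → ℝ}
    (hv : ∀ j, 0 < v j) {ν : ℝ} (hν : 0 < ν) :
    multivariateStudent μ (Matrix.diagonal v) ν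
      = (stdStudent (EuclideanSpace ℝ (Fin m)) ((ν + m) / 2)).map (studentMap μ v ν) := by
  have hA := measurable_studentMap μ v ν
  have hp := measurable_studentPDFReal_diagonal μ hv ν
  have hc : 0 ≤ ∏ j, Real.sqrt (ν * v j) := Finset.prod_nonneg fun j _ => Real.sqrt_nonneg _
  ext B hB
  -- Lebesgue measure is replaced by its rescaled pushforward in order to change variables on the
  -- left; the last rewrite undoes the replacement on the right.
  rw [multivariateStudent, withDensity_apply _ hB, Measure.map_apply hA hB, stdStudent,
    withDensity_apply _ (hA hB), ← map_studentMap_volume μ hv hν, Measure.restrict_smul,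
    lintegral_smul_measure, setLIntegral_map hB (by fun_prop) hA, smul_eq_mul,
    ← lintegral_const_mul _ (by fun_prop), map_studentMap_volume μ hv hν]
  congr 1 with w
  rw [← ENNReal.ofReal_mul hc, studentPDFReal_diagonal μ hv,
    diagMahalanobisSq_studentMap_self μ hv hν, ← mul_assoc, studentConst_mul_prod hv hν,
    finrank_euclideanSpace_fin, div_eq_inv_mul (_ ^ _)]

lemma isProbabilityMeasure_multivariateStudent_diagonal (μ : EuclideanSpace ℝ (Fin m))
    {v : Fin m → ℝ} (hv : ∀ j, 0 < v j) {ν : ℝ} (hν : 0 < ν) :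
    IsProbabilityMeasure (multivariateStudent μ (Matrix.diagonal v) ν) := by
  have := isProbabilityMeasure_stdStudent (V := EuclideanSpace ℝ (Fin m)) (s := (ν + m) / 2)
    (by rw [finrank_euclideanSpace_fin]; linarith)
  rw [multivariateStudent_diagonal_eq_map μ hv hν]
  exact Measure.isProbabilityMeasure_map (measurable_studentMap μ v ν).aemeasurable

end MultivariateStudent

/-! ### Log-likelihood ratios and data processing -/

section Densities

variable {α : Type*} [MeasurableSpace α] {ρ : Measure α} {p q : α → ℝ}

lemma withDensity_ofReal_eq_withDensity_div (hp : Measurable p) (hq : Measurable q)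
    (hq0 : ∀ z, 0 < q z) :
    ρ.withDensity (fun z => ENNReal.ofReal (p z))
      = (ρ.withDensity fun z => ENNReal.ofReal (q z)).withDensity
        fun z => ENNReal.ofReal (p z / q z) := by
  rw [← withDensity_mul _ (by fun_prop) (by fun_prop)]
  congr 1 with z
  rw [Pi.mul_apply, ← ENNReal.ofReal_mul (hq0 z).le, mul_div_cancel₀ _ (hq0 z).ne']

lemma llr_withDensity_ofReal [SigmaFinite (ρ.withDensity fun z => ENNReal.ofReal (q z))]
    (hp : Measurable p) (hq : Measurable q) (hp0 : ∀ z, 0 < p z) (hq0 : ∀ z, 0 < q z) :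
    ρ.withDensity (fun z => ENNReal.ofReal (p z))
        ≪ ρ.withDensity (fun z => ENNReal.ofReal (q z)) ∧
      llr (ρ.withDensity fun z => ENNReal.ofReal (p z))
          (ρ.withDensity fun z => ENNReal.ofReal (q z))
        =ᵐ[ρ.withDensity fun z => ENNReal.ofReal (p z)]
        fun z => Real.log (p z) - Real.log (q z) := by
  have heq := withDensity_ofReal_eq_withDensity_div (ρ := ρ) hp hq hq0
  have hac : ρ.withDensity (fun z => ENNReal.ofReal (p z))
      ≪ ρ.withDensity (fun z => ENNReal.ofReal (q z)) := by
    rw [heq]; exact withDensity_absolutelyContinuous _ _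
  refine ⟨hac, hac.ae_le ?_⟩
  have h := Measure.rnDeriv_withDensity (ρ.withDensity fun z => ENNReal.ofReal (q z))
    (f := fun z => ENNReal.ofReal (p z / q z)) (by fun_prop)
  rw [← heq] at h
  filter_upwards [h] with z hz
  rw [llr, hz, ENNReal.toReal_ofReal (div_pos (hp0 z) (hq0 z)).le,
    Real.log_div (hp0 z).ne' (hq0 z).ne']

lemma klBoundedBy_of_integral_llr_le {P Q : Measure α} [IsProbabilityMeasure P]
    [IsProbabilityMeasure Q] {B : ℝ} (hac : P ≪ Q) (hint : Integrable (llr P Q) P)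
    (hB : ∫ z, llr P Q z ∂P ≤ B) : KLBoundedBy P Q B :=
  ⟨klDiv_ne_top hac hint, by rwa [toReal_klDiv_of_measure_eq hac (by simp)]⟩

lemma KLBoundedBy.bind {β : Type*} [MeasurableSpace β] {P Q : Measure α}
    [IsFiniteMeasure P] [IsFiniteMeasure Q] {B : ℝ} (h : KLBoundedBy P Q B)
    (κ : Kernel α β) [IsMarkovKernel κ] : KLBoundedBy (P.bind κ) (Q.bind κ) B := by
  have hle : klDiv (P.bind κ) (Q.bind κ) ≤ klDiv P Q := klDiv_comp_right_le P Q κ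
  exact ⟨ne_top_of_le_ne_top h.1 hle, (ENNReal.toReal_mono h.1 hle).trans h.2⟩

end Densities

/-! ### Divergence between two Student laws -/

section StudentDivergence

variable {m : ℕ} {μ₀ μ₁ : EuclideanSpace ℝ (Fin m)} {v₀ v₁ : Fin m → ℝ} {ν : ℝ}

lemma log_studentPDFReal_diagonal (μ : EuclideanSpace ℝ (Fin m)) {v : Fin m → ℝ}
    (hv : ∀ j, 0 < v j) (hν : 0 < ν) (z : EuclideanSpace ℝ (Fin m)) :
    Real.log (studentPDFReal μ (Matrix.diagonal v) ν z)
      = Real.log (studentConst m v ν)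
        - (ν + m) / 2 * Real.log (1 + diagMahalanobisSq μ v z / ν) := by
  have h2 := diagMahalanobisSq_nonneg μ hv z
  have h3 : 0 < 1 + diagMahalanobisSq μ v z / ν := by positivity
  rw [studentPDFReal_diagonal μ hv, Real.log_mul (studentConst_pos hv hν).ne' (by positivity),
    Real.log_rpow h3]
  ring

/-- The tangent to `log` at `e` passes through the origin, so no additive constant appears. This is
the source of the `e` in `boundC₂`. -/
lemma log_le_div_exp_one {x : ℝ} (hx : 0 < x) : Real.log x ≤ x / Real.exp 1 := by
  have h := Real.log_le_sub_one_of_pos (div_pos hx (Real.exp_pos 1))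
  rw [Real.log_div hx.ne' (Real.exp_ne_zero 1), Real.log_exp] at h
  linarith

lemma log_studentConst_sub_le (hv₀ : ∀ j, 0 < v₀ j) (hv₁ : ∀ j, 0 < v₁ j) (hν : 0 < ν) {R : ℝ}
    (hR : ∀ j, v₀ j / v₁ j ≤ R) :
    Real.log (studentConst m v₁ ν) - Real.log (studentConst m v₀ ν)
      ≤ m * R / (2 * Real.exp 1) := by
  have h1 : 0 < Real.Gamma ((ν + m) / 2) := Real.Gamma_pos_of_pos (by positivity)
  have h2 : 0 < Real.Gamma (ν / 2) * (ν * Real.pi) ^ ((m : ℝ) / 2) :=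
    mul_pos (Real.Gamma_pos_of_pos (by positivity)) (by positivity)
  have hlog : ∀ v : Fin m → ℝ, (∀ j, 0 < v j) → Real.log (studentConst m v ν)
      = Real.log (Real.Gamma ((ν + m) / 2))
        - Real.log (Real.Gamma (ν / 2) * (ν * Real.pi) ^ ((m : ℝ) / 2))
        - (∑ j, Real.log (v j)) / 2 := by
    intro v hv
    have h3 : 0 < ∏ j, v j := Finset.prod_pos fun j _ => hv j
    rw [studentConst, Real.log_div h1.ne' (by positivity), Real.log_mul h2.ne' (by positivity),
      Real.log_sqrt h3.le, Real.log_prod fun j _ => (hv j).ne']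
    ring
  have hsum : ∑ j, Real.log (v₀ j / v₁ j) ≤ ∑ _j : Fin m, R / Real.exp 1 :=
    Finset.sum_le_sum fun j _ => (log_le_div_exp_one (div_pos (hv₀ j) (hv₁ j))).trans
      (by gcongr; exact hR j)
  have hsub : ∑ j, Real.log (v₀ j / v₁ j)
      = ∑ j, Real.log (v₀ j) - ∑ j, Real.log (v₁ j) := by
    rw [← Finset.sum_sub_distrib]
    exact Finset.sum_congr rfl fun j _ => Real.log_div (hv₀ j).ne' (hv₁ j).ne'
  rw [hsub, Finset.sum_const, Finset.card_univ, Fintype.card_fin, nsmul_eq_mul] at hsum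
  rw [hlog v₁ hv₁, hlog v₀ hv₀]
  calc _ = (∑ j, Real.log (v₀ j) - ∑ j, Real.log (v₁ j)) / 2 := by ring
    _ ≤ (m * (R / Real.exp 1)) / 2 := by gcongr
    _ = _ := by ring

/-- The linear part of the Mahalanobis distance from `Student(μ₀, diag(v₀), ν)` after
standardizing `Student(μ₁, diag(v₁), ν)`. -/
noncomputable def crossVector (μ₀ μ₁ : EuclideanSpace ℝ (Fin m)) (v₀ v₁ : Fin m → ℝ) (ν : ℝ) :
    EuclideanSpace ℝ (Fin m) :=
  WithLp.toLp 2 fun j => 2 * (μ₁ j - μ₀ j) * Real.sqrt (ν * v₁ j) / (v₀ j * ν)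

/-- Each coordinate square is expanded. The cross term is kept exact, since its mean vanishes, and
only the constant and quadratic terms are estimated. -/
lemma diagMahalanobisSq_studentMap_le (hv₀ : ∀ j, 0 < v₀ j) (hv₁ : ∀ j, 0 < v₁ j) (hν : 0 < ν)
    {R lam D : ℝ} (hlam : 0 < lam) (hR : ∀ j, v₁ j / v₀ j ≤ R) (hmin : ∀ j, lam ≤ v₀ j)
    (hD : ‖μ₁ - μ₀‖ ≤ D) (w : EuclideanSpace ℝ (Fin m)) :
    diagMahalanobisSq μ₀ v₀ (studentMap μ₁ v₁ ν w) / ν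
      ≤ D ^ 2 / (ν * lam) + inner ℝ (crossVector μ₀ μ₁ v₀ v₁ ν) w + R * ‖w‖ ^ 2 := by
  have hD2 : ‖μ₁ - μ₀‖ ^ 2 / (ν * lam) ≤ D ^ 2 / (ν * lam) := by gcongr
  refine le_trans ?_ (add_le_add_left (add_le_add_left hD2 _) _)
  rw [EuclideanSpace.norm_sq_eq, EuclideanSpace.norm_sq_eq, PiLp.inner_apply, diagMahalanobisSq,
    Finset.sum_div, Finset.sum_div, Finset.mul_sum, ← Finset.sum_add_distrib,
    ← Finset.sum_add_distrib]
  refine Finset.sum_le_sum fun j _ => ?_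
  have h0 := hv₀ j
  have h1 := hv₁ j
  have hs : Real.sqrt (ν * v₁ j) ^ 2 = ν * v₁ j := Real.sq_sqrt (by positivity)
  have hexp : (studentMap μ₁ v₁ ν w j - μ₀ j) ^ 2 / v₀ j / ν
      = (μ₁ j - μ₀ j) ^ 2 / (ν * v₀ j) + crossVector μ₀ μ₁ v₀ v₁ ν j * w j
        + v₁ j / v₀ j * w j ^ 2 := by
    rw [studentMap_apply, crossVector]
    field_simp
    linear_combination (w j) ^ 2 * hs
  simp only [Real.norm_eq_abs, sq_abs, PiLp.sub_apply]
  rw [hexp]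
  have e1 : inner ℝ (crossVector μ₀ μ₁ v₀ v₁ ν j) (w j)
      = crossVector μ₀ μ₁ v₀ v₁ ν j * w j := by simp [mul_comm]
  rw [e1]
  have hm := hmin j
  gcongr
  exact hR j

/-- The two variance ratios play different roles: `v₁ / v₀` controls the second-moment term inside
the logarithm, `v₀ / v₁` the quotient of normalizing constants. -/
theorem klBoundedBy_multivariateStudent_diagonal (hν : 2 < ν) {R lam D : ℝ} (hlam : 0 < lam)
    (hR₀ : 0 ≤ R) (hR : ∀ j, v₁ j / v₀ j ≤ R) (hR' : ∀ j, v₀ j / v₁ j ≤ R)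
    (hv₀ : ∀ j, lam ≤ v₀ j) (hv₁ : ∀ j, 0 < v₁ j) (hD : ‖μ₁ - μ₀‖ ≤ D) :
    KLBoundedBy (multivariateStudent μ₁ (Matrix.diagonal v₁) ν)
      (multivariateStudent μ₀ (Matrix.diagonal v₀) ν)
      (m * R / (2 * Real.exp 1) + (ν + m) / 2 *
        (Real.log (1 + m * R / (ν - 2) + D ^ 2 / (ν * lam))
          - realDigamma ((ν + m) / 2) + realDigamma (ν / 2))) := by
  have hν0 : 0 < ν := by linarith
  have hv₀' : ∀ j, 0 < v₀ j := fun j => hlam.trans_le (hv₀ j)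
  have hP := isProbabilityMeasure_multivariateStudent_diagonal μ₁ hv₁ hν0
  have hQ := isProbabilityMeasure_multivariateStudent_diagonal μ₀ hv₀' hν0
  have hfin := finrank_euclideanSpace_fin (𝕜 := ℝ) (n := m)
  have hs1 : (Module.finrank ℝ (EuclideanSpace ℝ (Fin m)) : ℝ) / 2 + 1 < (ν + m) / 2 := by
    rw [hfin]; linarith
  have hs : (Module.finrank ℝ (EuclideanSpace ℝ (Fin m)) : ℝ) / 2 < (ν + m) / 2 := by linarith
  have hT := isProbabilityMeasure_stdStudent hs
  set T := stdStudent (EuclideanSpace ℝ (Fin m)) ((ν + m) / 2) with hTdef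
  have hA := measurable_studentMap μ₁ v₁ ν
  have hmap := multivariateStudent_diagonal_eq_map μ₁ hv₁ hν0
  have hp := measurable_studentPDFReal_diagonal μ₁ hv₁ ν
  have hq := measurable_studentPDFReal_diagonal μ₀ hv₀' ν
  have hmah := measurable_diagMahalanobisSq μ₀ v₀
  have hσ : SigmaFinite ((volume : Measure (EuclideanSpace ℝ (Fin m))).withDensity
      fun z => ENNReal.ofReal (studentPDFReal μ₀ (Matrix.diagonal v₀) ν z)) :=
    inferInstanceAs (SigmaFinite (multivariateStudent μ₀ (Matrix.diagonal v₀) ν))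
  obtain ⟨hac, hllr⟩ := llr_withDensity_ofReal
    (ρ := (volume : Measure (EuclideanSpace ℝ (Fin m))))
    (p := studentPDFReal μ₁ (Matrix.diagonal v₁) ν)
    (q := studentPDFReal μ₀ (Matrix.diagonal v₀) ν)
    hp hq (studentPDFReal_diagonal_pos μ₁ hv₁ hν0) (studentPDFReal_diagonal_pos μ₀ hv₀' hν0)
  change multivariateStudent μ₁ (Matrix.diagonal v₁) ν
    ≪ multivariateStudent μ₀ (Matrix.diagonal v₀) ν at hac
  change llr (multivariateStudent μ₁ (Matrix.diagonal v₁) ν)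
    (multivariateStudent μ₀ (Matrix.diagonal v₀) ν)
    =ᵐ[multivariateStudent μ₁ (Matrix.diagonal v₁) ν] _ at hllr
  set c := crossVector μ₀ μ₁ v₀ v₁ ν
  -- `B` is the mean of the majorant `Y` below, hence the right tangent point for Jensen's
  -- inequality.
  set B := 1 + m * R / (ν - 2) + D ^ 2 / (ν * lam) with hB
  have hB1 : 0 < B := by
    have : 0 < ν - 2 := by linarith
    positivity
  set k := Real.log (studentConst m v₁ ν) - Real.log (studentConst m v₀ ν)

  set X : EuclideanSpace ℝ (Fin m) → ℝ :=
    fun w => 1 + diagMahalanobisSq μ₀ v₀ (studentMap μ₁ v₁ ν w) / ν with hX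
  set Y : EuclideanSpace ℝ (Fin m) → ℝ :=
    fun w => 1 + D ^ 2 / (ν * lam) + inner ℝ c w + R * ‖w‖ ^ 2 with hY
  have hX1 : ∀ w, 1 ≤ X w := fun w => by
    have := diagMahalanobisSq_nonneg μ₀ hv₀' (studentMap μ₁ v₁ ν w)
    simp only [hX, le_add_iff_nonneg_right]
    positivity
  have hXY : ∀ w, X w ≤ Y w := fun w => by
    have := diagMahalanobisSq_studentMap_le hv₀' hv₁ hν0 hlam hR hv₀ hD w
    simp only [hX, hY]
    linarith
  -- Jensen in pointwise form: the tangent to `log` at `B`. Since also `log X ≥ 0`, the same bound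
  -- supplies the integrable majorant for `log X`.
  have hlogX : ∀ w, Real.log (X w) ≤ Real.log B + Y w / B - 1 := fun w => by
    have hX0 : 0 < X w := by linarith [hX1 w]
    have h1 := Real.log_le_sub_one_of_pos (div_pos hX0 hB1)
    rw [Real.log_div hX0.ne' hB1.ne'] at h1
    have h2 : X w / B ≤ Y w / B := by gcongr; exact hXY w
    linarith
  have hYint : Integrable Y T :=
    ((integrable_const _).add (integrable_inner_stdStudent hs1 c)).add
      ((integrable_norm_sq_stdStudent hs1).const_mul R)
  have hYeq : ∫ w, Y w ∂T = B := by
    have h1 : Integrable (fun w => 1 + D ^ 2 / (ν * lam) + inner ℝ c w) T :=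
      (integrable_const _).add (integrable_inner_stdStudent hs1 c)
    simp only [hY]
    rw [integral_add h1 ((integrable_norm_sq_stdStudent hs1).const_mul R),
      integral_add (integrable_const _) (integrable_inner_stdStudent hs1 c),
      integral_inner_stdStudent hs, integral_const_mul, integral_norm_sq_stdStudent hs1, hfin, hB]
    have h2 : ν - 2 ≠ 0 := by linarith
    have h3 : (ν + m) / 2 - 1 - (m : ℝ) / 2 = (ν - 2) / 2 := by ring
    rw [h3]
    simp only [integral_const, probReal_univ, smul_eq_mul, one_mul]
    field_simp
    ring
  have hVint : Integrable (fun w => Real.log B + Y w / B) T :=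
    (integrable_const _).add (hYint.div_const _)
  have hUint : Integrable (fun w => Real.log B + Y w / B - 1) T := hVint.sub (integrable_const _)
  have hUeq : ∫ w, (Real.log B + Y w / B - 1) ∂T = Real.log B := by
    rw [integral_sub hVint (integrable_const _),
      integral_add (integrable_const _) (hYint.div_const _), integral_div, hYeq,
      div_self hB1.ne']
    simp
  have hXint : Integrable (fun w => Real.log (X w)) T := by
    refine hUint.mono' (Measurable.aestronglyMeasurable ?_) (.of_forall fun w => ?_)
    · have := hmah.comp hA
      simp only [hX]
      exact Real.measurable_log.comp ((this.div_const ν).const_add 1)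
    · rw [Real.norm_of_nonneg (Real.log_nonneg (hX1 w))]
      exact hlogX w
  have hWint := integrable_log_stdStudent hs1
  have hWeq := integral_log_stdStudent hs1
  rw [hfin, show (ν + m) / 2 - (m : ℝ) / 2 = ν / 2 by ring] at hWeq
  have hratio : ∀ w, Real.log (studentPDFReal μ₁ (Matrix.diagonal v₁) ν (studentMap μ₁ v₁ ν w))
      - Real.log (studentPDFReal μ₀ (Matrix.diagonal v₀) ν (studentMap μ₁ v₁ ν w))
      = k - (ν + m) / 2 * Real.log (1 + ‖w‖ ^ 2) + (ν + m) / 2 * Real.log (X w) := fun w => by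
    rw [log_studentPDFReal_diagonal μ₁ hv₁ hν0, log_studentPDFReal_diagonal μ₀ hv₀' hν0,
      diagMahalanobisSq_studentMap_self μ₁ hv₁ hν0]
    ring
  have hGint : Integrable (fun w => k - (ν + m) / 2 * Real.log (1 + ‖w‖ ^ 2)) T :=
    (integrable_const k).sub (hWint.const_mul _)
  have hFint : Integrable
      (fun w => k - (ν + m) / 2 * Real.log (1 + ‖w‖ ^ 2) + (ν + m) / 2 * Real.log (X w)) T :=
    hGint.add (hXint.const_mul _)
  have hdiff : Measurable fun z => Real.log (studentPDFReal μ₁ (Matrix.diagonal v₁) ν z)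
      - Real.log (studentPDFReal μ₀ (Matrix.diagonal v₀) ν z) := hp.log.sub hq.log
  refine klBoundedBy_of_integral_llr_le hac ?_ ?_
  · refine Integrable.congr ?_ hllr.symm
    rw [hmap, integrable_map_measure hdiff.aestronglyMeasurable hA.aemeasurable]
    exact hFint.congr (.of_forall fun w => (hratio w).symm)
  · rw [integral_congr_ae hllr, hmap,
      integral_map hA.aemeasurable hdiff.aestronglyMeasurable]
    simp_rw [hratio]
    rw [integral_add hGint (hXint.const_mul _),
      integral_sub (integrable_const k) (hWint.const_mul _), integral_const_mul,
      integral_const_mul, hWeq]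
    have hle : ∫ w, Real.log (X w) ∂T ≤ Real.log B :=
      (integral_mono hXint hUint hlogX).trans_eq hUeq
    have hk := log_studentConst_sub_le hv₀' hv₁ hν0 hR'
    have hs0 : 0 ≤ (ν + m) / 2 := by positivity
    have := mul_le_mul_of_nonneg_left hle hs0
    simp only [integral_const, probReal_univ, smul_eq_mul, one_mul]
    linarith

end StudentDivergence

/-! ### From the logarithm to a bound affine in the label distance -/

section ElementaryBounds

lemma one_add_sq_le_exp {t : ℝ} (ht : 0 ≤ t) : 1 + t ^ 2 ≤ Real.exp t := by
  have h := Real.sum_le_exp_of_nonneg ht 4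
  simp only [Finset.sum_range_succ, Finset.range_zero, Finset.sum_empty] at h
  norm_num [Nat.factorial] at h
  -- The cubic Taylor polynomial minus `1 + t²` is `(t / 6) ((t - 3/2)² + 15/4)`.
  nlinarith [mul_nonneg ht (sq_nonneg (t - 3 / 2))]

/-- For `r ≥ 1` the argument is at most `1 + (r a + b)²`, hence at most `exp (r a + b)`. -/
lemma log_one_add_le {r a b : ℝ} (hr : 1 ≤ r) (ha : 0 ≤ a) (hb : 0 ≤ b) :
    Real.log (1 + 2 * r * a * b + a ^ 2) ≤ r * a + b := by
  have hr0 : 0 ≤ r := by linarith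
  rw [Real.log_le_iff_le_exp (by positivity)]
  refine le_trans ?_ (one_add_sq_le_exp (t := r * a + b) (by positivity))
  nlinarith [mul_nonneg (sub_nonneg.2 hr) (mul_nonneg (by linarith : 0 ≤ r + 1) (sq_nonneg a)),
    sq_nonneg b]

lemma student_bound_le {m : ℕ} {M L lam ν δ : ℝ} (hM : 0 < M) (hL : 0 < L) (hlam : 0 < lam)
    (hν : 2 < ν) (hm : m ≠ 0) (hδ : 0 ≤ δ) :
    m * (M * δ) / (2 * Real.exp 1) + (ν + m) / 2 *
        (Real.log (1 + m * (M * δ) / (ν - 2) + (L * δ) ^ 2 / (ν * lam))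
          - realDigamma ((ν + m) / 2) + realDigamma (ν / 2))
      ≤ boundC₁ m ν lam L M + boundC₂ m ν lam L M * δ := by
  have hα : 0 < alphaConst ν lam L := div_pos (Real.sqrt_pos.2 (by positivity)) hL
  have hα2 : alphaConst ν lam L ^ 2 = ν * lam / L ^ 2 := by
    rw [alphaConst, div_pow, Real.sq_sqrt (by positivity)]
  have hν2 : 0 < ν - 2 := by linarith
  have hr : 1 ≤ Real.sqrt m := Real.one_le_sqrt.2 (by exact_mod_cast Nat.one_le_iff_ne_zero.2 hm)
  have hr2 : Real.sqrt m ^ 2 = m := Real.sq_sqrt (by positivity)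
  set α := alphaConst ν lam L with hαdef
  -- With `r = √m`, `a²` must be the location term, and `b` is then fixed by matching `2 r a b` with
  -- the scale term. Thus `b` is free of `δ` and goes into `boundC₁`, while `r a` is linear in `δ`
  -- and goes into `boundC₂`.
  have key := log_one_add_le hr (a := δ / α) (b := M * Real.sqrt m * α / (2 * (ν - 2)))
    (by positivity) (by positivity)
  have e1 : 2 * Real.sqrt m * (δ / α) * (M * Real.sqrt m * α / (2 * (ν - 2)))
      = m * (M * δ) / (ν - 2) := by
    rw [← hr2]; field_simp
    simp
  have e2 : (δ / α) ^ 2 = (L * δ) ^ 2 / (ν * lam) := by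
    rw [div_pow, hα2]; field_simp
  rw [e1, e2] at key
  have hs0 : 0 ≤ (ν + m) / 2 := by positivity
  have h := mul_le_mul_of_nonneg_left key hs0
  rw [boundC₁, boundC₂, ← hαdef]
  have e3 : (m * M / (2 * Real.exp 1) + (ν + m) * Real.sqrt m / (2 * α)) * δ
      = m * (M * δ) / (2 * Real.exp 1) + (ν + m) / 2 * (Real.sqrt m * (δ / α)) := by
    field_simp
  rw [e3]
  linarith

end ElementaryBounds

/-! ### Measurability of the Gaussian transition -/

section GaussianKernel

variable {m : ℕ}

open scoped MatrixOrder in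
lemma sqrt_diagonal {v : Fin m → ℝ} (hv : ∀ j, 0 ≤ v j) :
    CFC.sqrt (Matrix.diagonal v) = Matrix.diagonal fun j => Real.sqrt (v j) := by
  refine CFC.sqrt_unique ?_ ?_
  · rw [Matrix.diagonal_mul_diagonal]
    congr 1 with j
    exact Real.mul_self_sqrt (hv j)
  · exact Matrix.nonneg_iff_posSemidef.2
      (Matrix.PosSemidef.diagonal fun j => Real.sqrt_nonneg _)

lemma diagGaussian_eq_map (μ : EuclideanSpace ℝ (Fin m)) {v : Fin m → ℝ} (hv : ∀ j, 0 ≤ v j) :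
    diagGaussian μ v = (stdGaussian (EuclideanSpace ℝ (Fin m))).map
      fun x => WithLp.toLp 2 fun j => μ j + Real.sqrt (v j) * x j := by
  rw [diagGaussian, multivariateGaussian, sqrt_diagonal hv]
  congr 1 with x j
  simp [Matrix.mulVec_diagonal]

instance isProbabilityMeasure_diagGaussian (μ : EuclideanSpace ℝ (Fin m)) (v : Fin m → ℝ) :
    IsProbabilityMeasure (diagGaussian μ v) := by
  unfold diagGaussian
  infer_instance

variable {α : Type*} [MeasurableSpace α] {μ : α → EuclideanSpace ℝ (Fin m)} {v : α → Fin m → ℝ}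

/-- Every measure in the family is the image of one standard Gaussian under a map jointly measurable
in parameter and point, so the mass of a measurable set is the measure of a section of a measurable
set. -/
lemma measurable_diagGaussian (hμ : Measurable μ) (hv : Measurable v)
    (hv0 : ∀ a j, 0 ≤ v a j) : Measurable fun a => diagGaussian (μ a) (v a) := by
  have hF : Measurable fun p : α × EuclideanSpace ℝ (Fin m) =>
      (WithLp.toLp 2 fun j => μ p.1 j + Real.sqrt (v p.1 j) * p.2 j :
        EuclideanSpace ℝ (Fin m)) := by
    refine (WithLp.measurable_toLp 2 (Fin m → ℝ)).comp (measurable_pi_lambda _ fun j => ?_)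
    have h1 : Measurable fun p : α × EuclideanSpace ℝ (Fin m) => v p.1 j :=
      (measurable_pi_apply j).comp (hv.comp measurable_fst)
    fun_prop
  refine Measure.measurable_of_measurable_coe _ fun B hB => ?_
  have h := measurable_measure_prodMk_left (ν := stdGaussian (EuclideanSpace ℝ (Fin m))) (hF hB)
  convert! h using 2 with a
  rw [diagGaussian_eq_map _ (hv0 a)]
  exact Measure.map_apply (hF.comp (measurable_prodMk_left (x := a))) hB

/-- The transition kernel of the supervised setting. -/
noncomputable def supervisedKernel (η : ℝ) (μ' : EuclideanSpace ℝ (Fin m)) (v' : Fin m → ℝ)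
    (hμ : Measurable μ) (hv : Measurable v) (hv0 : ∀ a j, 0 ≤ v a j) :
    Kernel α (EuclideanSpace ℝ (Fin m)) where
  toFun a := ENNReal.ofReal η • diagGaussian μ' v' +
    ENNReal.ofReal (1 - η) • diagGaussian (μ a) (v a)
  measurable' := by
    refine Measure.measurable_of_measurable_coe _ fun B hB => ?_
    have h := (Measure.measurable_coe hB).comp (measurable_diagGaussian hμ hv hv0)
    exact (h.const_mul (ENNReal.ofReal (1 - η))).const_add (ENNReal.ofReal η * diagGaussian μ' v' B)

lemma isMarkovKernel_supervisedKernel {η : ℝ} (hη0 : 0 ≤ η) (hη1 : η ≤ 1)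
    (μ' : EuclideanSpace ℝ (Fin m)) (v' : Fin m → ℝ) (hμ : Measurable μ) (hv : Measurable v)
    (hv0 : ∀ a j, 0 ≤ v a j) : IsMarkovKernel (supervisedKernel η μ' v' hμ hv hv0) := by
  refine ⟨fun a => ⟨?_⟩⟩
  change (ENNReal.ofReal η • diagGaussian μ' v' +
    ENNReal.ofReal (1 - η) • diagGaussian (μ a) (v a)) Set.univ = 1
  simp [← ENNReal.ofReal_add hη0 (sub_nonneg.2 hη1)]

end GaussianKernel

/-! ### The main theorem -/

theorem theorem2 {d k m : ℕ} {Θ K : Type*}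
    (𝒳 : Set (EuclideanSpace ℝ (Fin d)))
    (Δ : LabelSpace k → LabelSpace k → ℝ) (hΔ : IsLabelMetric Δ)
    (μθ : Θ → EuclideanSpace ℝ (Fin d) → LabelSpace k → EuclideanSpace ℝ (Fin m))
    (vθ : Θ → EuclideanSpace ℝ (Fin d) → LabelSpace k → Fin m → ℝ)
    (μκ : K → EuclideanSpace ℝ (Fin m) → EuclideanSpace ℝ (Fin m))
    (vκ : K → EuclideanSpace ℝ (Fin m) → Fin m → ℝ)
    (hμκ : ∀ κ, Measurable (μκ κ)) (hvκ : ∀ κ, Measurable (vκ κ))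
    (hvκ_nonneg : ∀ κ z j, 0 ≤ vκ κ z j)
    (M L lam ν : ℝ) (hM : 0 < M) (hL : 0 < L) (hlam : 0 < lam) (hν : 2 < ν)
    (h_ratio : ∀ θ, ∀ x ∈ 𝒳, ∀ y y', y ≠ y' →
      ∀ j, vθ θ x y j / vθ θ x y' j ≤ M * Δ y y')
    (h_lip : ∀ θ, ∀ x ∈ 𝒳, ∀ y y', ‖μθ θ x y - μθ θ x y'‖ ≤ L * Δ y y')
    (h_min : ∀ θ, ∀ x ∈ 𝒳, ∀ y j, lam ≤ vθ θ x y j)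
    (θ : Θ) (κ : K) (x : EuclideanSpace ℝ (Fin d)) (hx : x ∈ 𝒳)
    (y₀ y₁ : LabelSpace k) (hy : y₀ ≠ y₁) :
    KLBoundedBy
        (latentLaw (μκ κ) (vκ κ) (shiftedLatentLaw ν (μθ θ x y₁) (vθ θ x y₁)))
        (latentLaw (μκ κ) (vκ κ) (shiftedLatentLaw ν (μθ θ x y₀) (vθ θ x y₀)))
        (boundC₁ m ν lam L M + boundC₂ m ν lam L M * Δ y₀ y₁) ∧
      (∀ η : ℝ, 0 ≤ η → η ≤ 1 → ∀ y : LabelSpace k,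
        KLBoundedBy
          (supervisedLatentLaw η (μθ θ x y) (vθ θ x y) (μκ κ) (vκ κ)
            (shiftedLatentLaw ν (μθ θ x y₁) (vθ θ x y₁)))
          (supervisedLatentLaw η (μθ θ x y) (vθ θ x y) (μκ κ) (vκ κ)
            (shiftedLatentLaw ν (μθ θ x y₀) (vθ θ x y₀)))
          (boundC₁ m ν lam L M + boundC₂ m ν lam L M * Δ y₀ y₁)) ∧
      KLBoundedBy
        (shiftedLatentLaw ν (μθ θ x y₁) (vθ θ x y₁))
        (shiftedLatentLaw ν (μθ θ x y₀) (vθ θ x y₀))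
        (boundC₁ m ν lam L M + boundC₂ m ν lam L M * Δ y₀ y₁) := by
  have hv₀ : ∀ j, lam ≤ vθ θ x y₀ j := h_min θ x hx y₀
  have hv₁ : ∀ j, lam ≤ vθ θ x y₁ j := h_min θ x hx y₁
  have hδ : 1 ≤ Δ y₀ y₁ := hΔ.one_le _ _ hy
  have hν0 : 0 < ν := by linarith
  have hR : ∀ j, vθ θ x y₁ j / vθ θ x y₀ j ≤ M * Δ y₀ y₁ := fun j => by
    rw [hΔ.symm y₀ y₁]; exact h_ratio θ x hx _ _ hy.symm j
  have hstudent : KLBoundedBy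
      (shiftedLatentLaw ν (μθ θ x y₁) (vθ θ x y₁))
      (shiftedLatentLaw ν (μθ θ x y₀) (vθ θ x y₀))
      (boundC₁ m ν lam L M + boundC₂ m ν lam L M * Δ y₀ y₁) := by
    have hkl := fun {D : ℝ} (hD : ‖μθ θ x y₁ - μθ θ x y₀‖ ≤ D) =>
      klBoundedBy_multivariateStudent_diagonal hν hlam
      (by positivity : 0 ≤ M * Δ y₀ y₁) hR (h_ratio θ x hx _ _ hy) hv₀
      (fun j => hlam.trans_le (hv₁ j)) hD
    rcases eq_or_ne m 0 with rfl | hm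
    -- In dimension zero `√m ≥ 1` fails and both constants vanish; the locations coincide, so `D =
    -- 0` makes the Student bound zero too.
    · have h := hkl (D := 0) (by simp [Subsingleton.elim (μθ θ x y₁) (μθ θ x y₀)])
      refine ⟨h.1, h.2.trans_eq ?_⟩
      simp [boundC₁, boundC₂]
    · have hD : ‖μθ θ x y₁ - μθ θ x y₀‖ ≤ L * Δ y₀ y₁ := by
        rw [hΔ.symm y₀ y₁]; exact h_lip θ x hx _ _
      have h := hkl hD
      exact ⟨h.1, h.2.trans (student_bound_le hM hL hlam hν hm (by linarith))⟩
  have hP : IsProbabilityMeasure (shiftedLatentLaw ν (μθ θ x y₁) (vθ θ x y₁)) :=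
    isProbabilityMeasure_multivariateStudent_diagonal _ (fun j => hlam.trans_le (hv₁ j)) hν0
  have hQ : IsProbabilityMeasure (shiftedLatentLaw ν (μθ θ x y₀) (vθ θ x y₀)) :=
    isProbabilityMeasure_multivariateStudent_diagonal _ (fun j => hlam.trans_le (hv₀ j)) hν0
  refine ⟨?_, fun η hη0 hη1 y => ?_, hstudent⟩
  · let k : Kernel (EuclideanSpace ℝ (Fin m)) (EuclideanSpace ℝ (Fin m)) :=
      ⟨_, measurable_diagGaussian (hμκ κ) (hvκ κ) (hvκ_nonneg κ)⟩
    have hk : IsMarkovKernel k := ⟨fun z => isProbabilityMeasure_diagGaussian _ _⟩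
    exact hstudent.bind k
  · have hk := isMarkovKernel_supervisedKernel hη0 hη1 (μθ θ x y) (vθ θ x y) (hμκ κ) (hvκ κ)
      (hvκ_nonneg κ)
    exact hstudent.bind (supervisedKernel η (μθ θ x y) (vθ θ x y) (hμκ κ) (hvκ κ) (hvκ_nonneg κ))
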